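/- Let $H=(V,E)$ be a hypergraph with finitely many hyperedges $e\subseteq V$, each finite and carrying a splitting function $w_e:\{A\subseteq e\}\to\mathbb{R}_{\ge 0}$ with $w_e(A)=w_e(e\setminus A)$ and $w_e(\emptyset)=w_e(e)=0$. Let $d_v=\sum_{e\ni v}w_e(\{v\})$, $\mathrm{vol}(S)=\sum_{v\in S}d_v$, let $E(S)$ be the set of hyperedges meeting $S$, let $\mathcal N(S)$ be the set of nodes $u$ for which some hyperedge contains $u$ and a node of $S$, and let $k$ be the maximum size of a hyperedge. Assume that every $w_e$ is cardinality-based ($w_e(A)=w_e(B)$ whenever $|A|=|B|$) and submodular ($w_e(A)+w_e(B)\ge w_e(A\cup B)+w_e(A\cap B)$), and is scaled to minimum nonzero penalty $1$ (it suffices that each $w_e$ is not identically zero and that all nonzero penalties are at least $1$). Let $R\subseteq V$ be a finite set none of whose nodes is isolated (that is, lies in no hyperedge), and let $\varepsilon>0$, $\alpha>0$. The terminal edge of a node $v$ joins $v$ to a source $s$ with weight $\alpha d_v$ if $v\in R$, and to a sink $t$ with weight $\alpha\varepsilon d_v$ if $v\notin R$. Consider the following algorithm. It maintains a local hypergraph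 $\mathcal L$ with nodes $V_L$ (besides $s,t$), hyperedges $E_L$ and terminal edges $E_L^{st}$, and a set $X$ of explored nodes. Initially $V_L=R\cup\mathcal N(R)$, $E_L=E(R)$, $E_L^{st}$ is the set of terminal edges of the nodes of $V_L$, and $X=\emptyset$. Each iteration picks any minimizer $S_L$, over all $S\subseteq V_L$, of $$\sum_{e\in E_L}w_e(e\cap S)+(\text{total weight of the terminal edges in } E_L^{st} \text{ that are cut by } S\cup\{s\}),$$ puts $N=S_L\setminus(R\cup X)$, and adds $\mathcal N(N)$ to $V_L$, $E(N)$ to $E_L$, the terminal edges of the nodes of $\mathcal N(N)$ to $E_L^{st}$, and $N$ to $X$. The iterations are repeated (at least once) until $N=\emptyset$. Then, at every point of every execution, the local hypergraph satisfies $$|E_L|\le \tfrac32\left(1+\tfrac1\varepsilon\right)\mathrm{vol}(R),\qquad |V_L|\le k\,\mathrm{vol}(R)\left(1+\tfrac1\varepsilon\right),\qquad |E_L^{st}|\le k\,\mathrm{vol}(R)\left(1+\tfrac1\varepsilon\right).$$ Hence the algorithm is strongly local, in the following sense. Every execution makes at most $1+\mathrm{vol}(R)/\varepsilon$ iterations.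 Moreover, let $T(n,m,\tau,\kappa)\in\mathbb N$, nondecreasing in each argument, bound the cost of one minimum cut computation on a local hypergraph with $n$ nodes, $m$ hyperedges, $\tau$ terminal edges and hyperedges of size at most $\kappa$; and let exploring a node $v$ (each node of $R$ at the start, and each node that is added to $X$) cost $1+\sum_{e\ni v}|e|$. Then the total cost is at most $$(1+k)\,\mathrm{vol}(R)\left(1+\tfrac1\varepsilon\right)+\left(1+\tfrac{\mathrm{vol}(R)}{\varepsilon}\right)T(a,b,a,k),\qquad a=\left\lfloor k\,\mathrm{vol}(R)\left(1+\tfrac1\varepsilon\right)\right\rfloor,\quad b=\left\lfloor\tfrac32\left(1+\tfrac1\varepsilon\right)\mathrm{vol}(R)\right\rfloor,$$ which does not depend on the size of $H$. -/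

import Mathlib

/-- A finite hypergraph on the node set `V` whose hyperedges `edge e ⊆ V` are indexed by `E`
(parallel hyperedges are allowed; a set of hyperedges is the case where `edge` is injective), each
hyperedge carrying a splitting function `w e`, read only at subsets `A ⊆ edge e`, that is
nonnegative, symmetric, and penalizes only cut hyperedges. -/
structure SplitHypergraph (V E : Type*) [DecidableEq V] where
  edge : E → Finset V
  w : E → Finset V → ℝ
  w_nonneg : ∀ e A, A ⊆ edge e → 0 ≤ w e A
  w_symm : ∀ e A, A ⊆ edge e → w e A = w e (edge e \ A)
  w_empty : ∀ e, w e ∅ = 0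

/-- The two terminals of an extended hypergraph: the source `s` and the sink `t`. -/
inductive Terminal
  | source
  | sink
  deriving DecidableEq

namespace SplitHypergraph

variable {V E : Type*} [DecidableEq V]

/-- Every splitting function depends only on the number of nodes on the given side of the split. -/
def CardinalityBased (H : SplitHypergraph V E) : Prop :=
  ∀ e A B, A ⊆ H.edge e → B ⊆ H.edge e → A.card = B.card → H.w e A = H.w e B

/-- Every splitting function is submodular on the subsets of its hyperedge. -/
def IsSubmodular (H : SplitHypergraph V E) : Prop :=
  ∀ e A B, A ⊆ H.edge e → B ⊆ H.edge e →
    H.w e (A ∪ B) + H.w e (A ∩ B) ≤ H.w e A + H.w e B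

/-- The normalization "minimum nonzero penalty `1`": every splitting function has a nonzero
penalty, and no nonzero penalty is smaller than `1`. This covers both the case where the minimum
is `1` for each hyperedge and the case where it is `1` over all hyperedges together. -/
def NonzeroPenaltiesGeOne (H : SplitHypergraph V E) : Prop :=
  ∀ e, (∃ A ⊆ H.edge e, H.w e A ≠ 0) ∧ ∀ A ⊆ H.edge e, H.w e A ≠ 0 → 1 ≤ H.w e A

/-- A node is isolated if it lies in no hyperedge. -/
def Isolated (H : SplitHypergraph V E) (v : V) : Prop :=
  ∀ e, v ∉ H.edge e

variable [Fintype E]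

/-- `E(v)`, the hyperedges that contain `v`. -/
def incident (H : SplitHypergraph V E) (v : V) : Finset E :=
  {e | v ∈ H.edge e}

/-- `E(S)`, the hyperedges that contain at least one node of `S`. -/
def incidentSet [DecidableEq E] (H : SplitHypergraph V E) (S : Finset V) : Finset E :=
  S.biUnion H.incident

/-- `N(v)`, the nodes that share a hyperedge with `v`. -/
def neighbors (H : SplitHypergraph V E) (v : V) : Finset V :=
  (H.incident v).biUnion H.edge

/-- `N(S)`, the union of the neighborhoods of the nodes of `S`. -/
def neighborsSet (H : SplitHypergraph V E) (S : Finset V) : Finset V :=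
  S.biUnion H.neighbors

/-- The hypergraph degree `d_v`, the sum of `w_e({v})` over the hyperedges that contain `v`. -/
def degree (H : SplitHypergraph V E) (v : V) : ℝ :=
  ∑ e ∈ H.incident v, H.w e {v}

/-- The hypergraph volume of `S`. -/
def vol (H : SplitHypergraph V E) (S : Finset V) : ℝ :=
  ∑ v ∈ S, H.degree v

/-- The maximum size of a hyperedge (`0` if there are no hyperedges). -/
def maxEdgeSize (H : SplitHypergraph V E) : ℕ :=
  Finset.univ.sup fun e => (H.edge e).card

/-- The terminal edge of `v` in the extended hypergraph: nodes of `R` are attached to the source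
and all other nodes to the sink. -/
def terminalEdge (R : Finset V) (v : V) : V × Terminal :=
  (v, if v ∈ R then .source else .sink)

/-- The terminal edges of the nodes of `S`. -/
def terminalEdges (R S : Finset V) : Finset (V × Terminal) :=
  S.image (terminalEdge R)

/-- The weight of a terminal edge: `α d_v` at the source and `α ε d_v` at the sink. -/
def terminalWeight (H : SplitHypergraph V E) (ε α : ℝ) : V × Terminal → ℝ
  | (v, .source) => α * H.degree v
  | (v, .sink) => α * ε * H.degree v

/-- The terminal edge is cut by `S ∪ {s}`. -/
def TerminalCut (S : Finset V) : V × Terminal → Prop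
  | (v, .source) => v ∉ S
  | (v, .sink) => v ∈ S

/-- The variables of the local minimum cut algorithm: the nodes `V_L` (other than `s` and `t`),
the hyperedges `E_L` and the terminal edges `E_L^st` of the local hypergraph, the set `X` of
explored nodes, the last minimum cut set `S_L`, and the set `N` around which the local hypergraph
was last expanded. -/
structure LocalState (V E : Type*) where
  nodes : Finset V
  hyperedges : Finset E
  terminals : Finset (V × Terminal)
  explored : Finset V
  cutSet : Finset V
  frontier : Finset V

open Classical in
/-- The value of the cut `S ∪ {s}` in the local hypergraph `L`. -/
noncomputable def localCut (H : SplitHypergraph V E) (ε α : ℝ) (L : LocalState V E)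
    (S : Finset V) : ℝ :=
  ∑ e ∈ L.hyperedges, H.w e (H.edge e ∩ S) +
    ∑ τ ∈ L.terminals with TerminalCut S τ, H.terminalWeight ε α τ

/-- `S` is a minimizer of the local cut value among the subsets of `V_L`. -/
def IsMinLocalCut (H : SplitHypergraph V E) (ε α : ℝ) (L : LocalState V E) (S : Finset V) :
    Prop :=
  S ⊆ L.nodes ∧ ∀ S' ⊆ L.nodes, H.localCut ε α L S ≤ H.localCut ε α L S'

variable [DecidableEq E]

/-- The initial local hypergraph: the nodes `R ∪ N(R)`, their terminal edges, and the hyperedges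
`E(R)`. -/
def initState (H : SplitHypergraph V E) (R : Finset V) : LocalState V E where
  nodes := R ∪ H.neighborsSet R
  hyperedges := H.incidentSet R
  terminals := terminalEdges R (R ∪ H.neighborsSet R)
  explored := ∅
  cutSet := ∅
  frontier := ∅

/-- One pass through the loop body, once the minimum cut set `S` has been found: put
`N = S \ (R ∪ X)`, expand the local hypergraph around `N`, and add `N` to `X`. -/
def loopBody (H : SplitHypergraph V E) (R : Finset V) (L : LocalState V E) (S : Finset V) :
    LocalState V E :=
  let N := S \ (R ∪ L.explored)
  { nodes := L.nodes ∪ H.neighborsSet N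
    hyperedges := L.hyperedges ∪ H.incidentSet N
    terminals := L.terminals ∪ terminalEdges R (H.neighborsSet N)
    explored := L.explored ∪ N
    cutSet := S
    frontier := N }

/-- The cost of exploring the nodes of `N`: for each `v ∈ N`, one query for `E(v)`, and one unit
for each member of each hyperedge that the query returns. -/
def exploreCost (H : SplitHypergraph V E) (N : Finset V) : ℕ :=
  ∑ v ∈ N, (1 + ∑ e ∈ H.incident v, (H.edge e).card)

/-- The maximum size of a hyperedge of the local hypergraph. -/
def LocalState.maxEdgeSize (H : SplitHypergraph V E) (L : LocalState V E) : ℕ :=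
  L.hyperedges.sup fun e => (H.edge e).card

/-- `H.Exec R ε α T i c L`: some execution of the do-while loop, with input `R`, `ε`, `α`, is in
state `L` after exactly `i` passes through the loop body, at a total cost of `c`. The loop is
entered unconditionally, and is repeated as long as the last `N` is nonempty. Any minimizer may be
returned by the minimum cut solver, whose running time is at most `T n m τ κ` on a local hypergraph
with `n` nodes, `m` hyperedges, `τ` terminal edges, and hyperedges of size at most `κ`. -/
inductive Exec (H : SplitHypergraph V E) (R : Finset V) (ε α : ℝ) (T : ℕ → ℕ → ℕ → ℕ → ℕ) :
    ℕ → ℕ → LocalState V E → Prop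
  | init : Exec H R ε α T 0 (H.exploreCost R) (H.initState R)
  | pass {i c : ℕ} {L : LocalState V E} (S : Finset V) (b : ℕ) :
      Exec H R ε α T i c L → (i = 0 ∨ L.frontier.Nonempty) → H.IsMinLocalCut ε α L S →
      b ≤ T L.nodes.card L.hyperedges.card L.terminals.card (L.maxEdgeSize H) →
      Exec H R ε α T (i + 1) (c + b + H.exploreCost (S \ (R ∪ L.explored))) (H.loopBody R L S)

end SplitHypergraph

/-!
The explored set `X` is controlled by an invariant: for every node set `S`,
`α ε vol(X \ S) ≤ cut(S) + α vol(R \ S)`,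
where `cut` sums the penalties of the hyperedges of the local hypergraph.
By max-flow/min-cut duality this says that the local hypergraph carries a flow from the source that
saturates the sink edges of all explored nodes. It is preserved by each pass of the loop
(`saturation_expand`): if `S₀` is the minimizer found in the pass, then uncrossing `S` with `S₀` by
submodularity, comparing `S₀` with `S ∩ S₀`, and applying the invariant to `S ∪ S₀` gives the
inequality for `X ∪ (S₀ \ R)`; enlarging the hyperedge set afterwards only increases `cut(S)`.
At `S = ∅` the invariant reads `ε vol(X) ≤ vol(R)`, so `vol(R ∪ X) ≤ (1 + 1/ε) vol(R)`.

Under cardinality-based submodularity a splitting function that vanishes on singletons vanishes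
identically, so the normalization gives `w_e({v}) ≥ 1`, and `d_v` is at least the number of
hyperedges at `v` (`card_incident_le_degree`). As the local hypergraph is exactly the one spanned by
the hyperedges that meet `R ∪ X`, its size and the exploration cost are bounded by multiples of
`vol(R ∪ X)`. Every pass but the last explores a new node, which has degree at least one, so
the number of passes is at most `1 + vol(X)`.
-/

namespace SplitHypergraph

variable {V E : Type*} [DecidableEq V] {H : SplitHypergraph V E}

/-! ### Hyperedge cuts -/

/-- The total penalty at `S` of the hyperedges in `F`, without the terminal edges. -/
def hyperedgeCut (H : SplitHypergraph V E) (F : Finset E) (S : Finset V) : ℝ :=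
  ∑ e ∈ F, H.w e (H.edge e ∩ S)

theorem hyperedgeCut_nonneg (F : Finset E) (S : Finset V) : 0 ≤ H.hyperedgeCut F S :=
  Finset.sum_nonneg fun e _ => H.w_nonneg e _ Finset.inter_subset_left

theorem hyperedgeCut_mono {F F' : Finset E} (h : F ⊆ F') (S : Finset V) :
    H.hyperedgeCut F S ≤ H.hyperedgeCut F' S :=
  Finset.sum_le_sum_of_subset_of_nonneg h fun e _ _ => H.w_nonneg e _ Finset.inter_subset_left

theorem hyperedgeCut_submodular (hsub : H.IsSubmodular) (F : Finset E) (S S' : Finset V) :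
    H.hyperedgeCut F (S ∪ S') + H.hyperedgeCut F (S ∩ S') ≤
      H.hyperedgeCut F S + H.hyperedgeCut F S' := by
  simp only [hyperedgeCut, ← Finset.sum_add_distrib]
  refine Finset.sum_le_sum fun e _ => ?_
  have h := hsub e (H.edge e ∩ S) (H.edge e ∩ S') Finset.inter_subset_left
    Finset.inter_subset_left
  rwa [← Finset.inter_union_distrib_left, ← Finset.inter_inter_distrib_left] at h

/-! ### Degrees dominate hyperedge counts -/

/-- If `w_e({v})` were zero, cardinality-basedness would make all singletons free, and
subadditivity would make `w_e` vanish. -/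
theorem one_le_w_singleton (hcard : H.CardinalityBased) (hsub : H.IsSubmodular)
    (hmin : H.NonzeroPenaltiesGeOne) {e : E} {v : V} (hv : v ∈ H.edge e) : 1 ≤ H.w e {v} := by
  have hv' : {v} ⊆ H.edge e := Finset.singleton_subset_iff.2 hv
  refine (hmin e).2 _ hv' fun h0 => ?_
  obtain ⟨A, hA, hA0⟩ := (hmin e).1
  refine hA0 ?_
  clear hA0
  induction A using Finset.induction_on with
  | empty => exact H.w_empty e
  | insert u A hu ih =>
    have hA' : A ⊆ H.edge e := (Finset.subset_insert u A).trans hA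
    have hu' : {u} ⊆ H.edge e := Finset.singleton_subset_iff.2 (hA (Finset.mem_insert_self u A))
    have hs := hsub e {u} A hu' hA'
    rw [← Finset.insert_eq, Finset.singleton_inter_of_notMem hu, H.w_empty, ih hA',
      hcard e {u} {v} hu' hv' (by simp), h0] at hs
    exact le_antisymm (by linarith) (H.w_nonneg e _ hA)

variable [Fintype E]

theorem mem_incident {v : V} {e : E} : e ∈ H.incident v ↔ v ∈ H.edge e := by
  simp [incident]

theorem degree_nonneg (v : V) : 0 ≤ H.degree v :=
  Finset.sum_nonneg fun e he =>
    H.w_nonneg e _ (Finset.singleton_subset_iff.2 (mem_incident.1 he))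

theorem vol_nonneg (S : Finset V) : 0 ≤ H.vol S :=
  Finset.sum_nonneg fun v _ => degree_nonneg v

theorem vol_mono {S S' : Finset V} (h : S ⊆ S') : H.vol S ≤ H.vol S' :=
  Finset.sum_le_sum_of_subset_of_nonneg h fun v _ _ => degree_nonneg v

theorem vol_union {S S' : Finset V} (h : Disjoint S S') : H.vol (S ∪ S') = H.vol S + H.vol S' :=
  Finset.sum_union h

theorem card_incident_le_degree (hcard : H.CardinalityBased) (hsub : H.IsSubmodular)
    (hmin : H.NonzeroPenaltiesGeOne) (v : V) : ((H.incident v).card : ℝ) ≤ H.degree v := by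
  have h := Finset.card_nsmul_le_sum (H.incident v) (fun e => H.w e {v}) 1 fun e he =>
    one_le_w_singleton hcard hsub hmin (mem_incident.1 he)
  simpa [degree] using h

theorem one_le_degree (hcard : H.CardinalityBased) (hsub : H.IsSubmodular)
    (hmin : H.NonzeroPenaltiesGeOne) {v : V} (hv : ¬ H.Isolated v) : 1 ≤ H.degree v := by
  have hne : (H.incident v).Nonempty := by
    simp only [Isolated, not_forall, not_not] at hv
    obtain ⟨e, he⟩ := hv
    exact ⟨e, mem_incident.2 he⟩
  exact le_trans (by exact_mod_cast hne.card_pos) (card_incident_le_degree hcard hsub hmin v)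

theorem card_le_vol (hcard : H.CardinalityBased) (hsub : H.IsSubmodular)
    (hmin : H.NonzeroPenaltiesGeOne) {S : Finset V} (hS : ∀ v ∈ S, ¬ H.Isolated v) :
    (S.card : ℝ) ≤ H.vol S := by
  have h := Finset.card_nsmul_le_sum S H.degree 1 fun v hv =>
    one_le_degree hcard hsub hmin (hS v hv)
  simpa [vol] using h

theorem card_edge_le (e : E) : (H.edge e).card ≤ H.maxEdgeSize :=
  Finset.le_sup (f := fun e => (H.edge e).card) (Finset.mem_univ e)

theorem localMaxEdgeSize_le (L : LocalState V E) : L.maxEdgeSize H ≤ H.maxEdgeSize :=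
  Finset.sup_le fun e _ => card_edge_le e

theorem not_isolated_of_mem_neighborsSet {S : Finset V} {v : V} (hv : v ∈ H.neighborsSet S) :
    ¬ H.Isolated v := by
  simp only [neighborsSet, neighbors, Finset.mem_biUnion] at hv
  obtain ⟨_, _, e, _, he⟩ := hv
  exact fun h => h e he

theorem subset_neighborsSet {S : Finset V} (hS : ∀ v ∈ S, ¬ H.Isolated v) :
    S ⊆ H.neighborsSet S := by
  intro v hv
  have := hS v hv
  simp only [Isolated, not_forall, not_not] at this
  obtain ⟨e, he⟩ := this
  simp only [neighborsSet, neighbors, Finset.mem_biUnion]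
  exact ⟨v, hv, e, mem_incident.2 he, he⟩

theorem neighborsSet_union (S S' : Finset V) :
    H.neighborsSet (S ∪ S') = H.neighborsSet S ∪ H.neighborsSet S' :=
  Finset.union_biUnion

theorem exploreCost_union {S S' : Finset V} (h : Disjoint S S') :
    H.exploreCost (S ∪ S') = H.exploreCost S + H.exploreCost S' :=
  Finset.sum_union h

theorem exploreCost_le (hcard : H.CardinalityBased) (hsub : H.IsSubmodular)
    (hmin : H.NonzeroPenaltiesGeOne) {S : Finset V} (hS : ∀ v ∈ S, ¬ H.Isolated v) :
    (H.exploreCost S : ℝ) ≤ (1 + H.maxEdgeSize) * H.vol S := by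
  rw [exploreCost, vol, Finset.mul_sum, Nat.cast_sum]
  refine Finset.sum_le_sum fun v hv => ?_
  have h1 := one_le_degree hcard hsub hmin (hS v hv)
  have h2 : ((∑ e ∈ H.incident v, (H.edge e).card : ℕ) : ℝ) ≤
      (H.incident v).card * H.maxEdgeSize := by
    exact_mod_cast Finset.sum_le_card_nsmul _ _ _ fun e _ => card_edge_le e
  have h3 := mul_le_mul_of_nonneg_right (card_incident_le_degree hcard hsub hmin v)
    (Nat.cast_nonneg (α := ℝ) H.maxEdgeSize)
  rw [Nat.cast_add, Nat.cast_one]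
  linarith

section Counting

variable [DecidableEq E]

theorem incidentSet_union (S S' : Finset V) :
    H.incidentSet (S ∪ S') = H.incidentSet S ∪ H.incidentSet S' :=
  Finset.union_biUnion

theorem card_incidentSet_le_vol (hcard : H.CardinalityBased) (hsub : H.IsSubmodular)
    (hmin : H.NonzeroPenaltiesGeOne) (S : Finset V) :
    ((H.incidentSet S).card : ℝ) ≤ H.vol S := by
  have h : ((H.incidentSet S).card : ℝ) ≤ ∑ v ∈ S, ((H.incident v).card : ℝ) := by
    exact_mod_cast Finset.card_biUnion_le
  exact h.trans (Finset.sum_le_sum fun v _ => card_incident_le_degree hcard hsub hmin v)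

theorem card_neighborsSet_le (hcard : H.CardinalityBased) (hsub : H.IsSubmodular)
    (hmin : H.NonzeroPenaltiesGeOne) (S : Finset V) :
    ((H.neighborsSet S).card : ℝ) ≤ H.maxEdgeSize * H.vol S := by
  have heq : H.neighborsSet S = (H.incidentSet S).biUnion H.edge :=
    (Finset.biUnion_biUnion S H.incident H.edge).symm
  have h : ((H.neighborsSet S).card : ℝ) ≤ (H.incidentSet S).card * H.maxEdgeSize := by
    rw [heq]
    exact_mod_cast Finset.card_biUnion_le_card_mul _ _ _ fun e _ => card_edge_le e
  have h2 := mul_le_mul_of_nonneg_right (card_incidentSet_le_vol hcard hsub hmin S)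
    (Nat.cast_nonneg (α := ℝ) H.maxEdgeSize)
  linarith

end Counting

/-! ### The local cut function -/

/-- If every node of the local hypergraph has its terminal edge, the local cut charges
the nodes of `R` missing from `S` at the source and the nodes of `S` outside `R` at the sink. -/
theorem localCut_eq (ε α : ℝ) {R S : Finset V} {L : LocalState V E}
    (hterm : L.terminals = terminalEdges R L.nodes) (hR : R ⊆ L.nodes) (hS : S ⊆ L.nodes) :
    H.localCut ε α L S =
      H.hyperedgeCut L.hyperedges S + α * H.vol (R \ S) + α * ε * H.vol (S \ R) := by
  classical
  rw [localCut, hyperedgeCut, hterm, terminalEdges, Finset.sum_filter, Finset.sum_image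
    (fun _ _ _ _ h => congrArg Prod.fst h), vol, vol, Finset.mul_sum, Finset.mul_sum, add_assoc]
  congr 1
  have h1 : R \ S = L.nodes.filter fun v => v ∈ R ∧ v ∉ S := by
    ext v
    simp only [Finset.mem_sdiff, Finset.mem_filter]
    exact ⟨fun h => ⟨hR h.1, h⟩, fun h => h.2⟩
  have h2 : S \ R = L.nodes.filter fun v => v ∈ S ∧ v ∉ R := by
    ext v
    simp only [Finset.mem_sdiff, Finset.mem_filter]
    exact ⟨fun h => ⟨hS h.1, h⟩, fun h => h.2⟩
  rw [h1, h2, Finset.sum_filter, Finset.sum_filter, ← Finset.sum_add_distrib]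
  refine Finset.sum_congr rfl fun v _ => ?_
  by_cases hvR : v ∈ R <;> by_cases hvS : v ∈ S <;>
    simp [terminalEdge, TerminalCut, terminalWeight, hvR, hvS]

/-! ### The saturation invariant -/

/-- Every cut set `S` leaves enough capacity to saturate the sink edges of `X`: the cut form of the
existence of a flow in the hypergraph with hyperedges `F` that saturates them. -/
def Saturates (H : SplitHypergraph V E) (R : Finset V) (ε α : ℝ) (F : Finset E) (X : Finset V) :
    Prop :=
  ∀ S : Finset V, α * ε * H.vol (X \ S) ≤ H.hyperedgeCut F S + α * H.vol (R \ S)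

theorem Saturates.mono {R X : Finset V} {ε α : ℝ} {F F' : Finset E} (hF : F ⊆ F')
    (h : H.Saturates R ε α F X) : H.Saturates R ε α F' X := fun S =>
  (h S).trans (add_le_add_left (hyperedgeCut_mono hF S) _)

/-- Nodes outside `R` in a minimum local cut set can be saturated in addition to `X`. -/
theorem saturation_expand (hsub : H.IsSubmodular) {R X S₀ : Finset V} {ε α : ℝ} (hε : 0 < ε)
    (hα : 0 < α) {L : LocalState V E} (hterm : L.terminals = terminalEdges R L.nodes)
    (hR : R ⊆ L.nodes) (hdisj : Disjoint R X) (hX : H.Saturates R ε α L.hyperedges X)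
    (hS₀ : H.IsMinLocalCut ε α L S₀) :
    H.Saturates R ε α L.hyperedges (X ∪ S₀ \ (R ∪ X)) := by
  intro S
  have hcut := hS₀.2 (S ∩ S₀) (Finset.inter_subset_right.trans hS₀.1)
  rw [localCut_eq ε α hterm hR hS₀.1,
    localCut_eq ε α hterm hR (Finset.inter_subset_right.trans hS₀.1)] at hcut
  have hunc := hyperedgeCut_submodular hsub L.hyperedges S S₀
  have hunion := hX (S ∪ S₀)
  have hsplit1 : H.vol (S₀ \ R) = H.vol ((S ∩ S₀) \ R) + H.vol ((S₀ \ R) \ S) := by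
    rw [← vol_union (by
      rw [Finset.disjoint_left]; intro a; simp only [Finset.mem_sdiff, Finset.mem_inter]; tauto)]
    congr 1; ext a; simp only [Finset.mem_sdiff, Finset.mem_inter, Finset.mem_union]; tauto
  -- The source edges cut by `S ∩ S₀` and by `S ∪ S₀` are together those cut by `S` and by `S₀`.
  have hsplit2 : H.vol (R \ (S ∩ S₀)) + H.vol (R \ (S ∪ S₀)) = H.vol (R \ S) + H.vol (R \ S₀) := by
    rw [Finset.sdiff_inter_distrib_right, Finset.sdiff_union_distrib]
    exact Finset.sum_union_inter
  have hcover : H.vol ((X ∪ S₀ \ (R ∪ X)) \ S) ≤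
      H.vol ((S₀ \ R) \ S) + H.vol (X \ (S ∪ S₀)) := by
    rw [← vol_union (by
      rw [Finset.disjoint_left]; intro a; simp only [Finset.mem_sdiff, Finset.mem_union]; tauto)]
    refine vol_mono fun a => ?_
    have ha : a ∈ R → a ∉ X := fun h => Finset.disjoint_left.1 hdisj h
    simp only [Finset.mem_sdiff, Finset.mem_union]
    tauto
  have hcover' := mul_le_mul_of_nonneg_left hcover (mul_pos hα hε).le
  rw [mul_add] at hcover'
  rw [hsplit1, mul_add] at hcut
  have h2 := congrArg (α * ·) hsplit2
  simp only [mul_add] at h2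
  linarith

theorem vol_le_of_saturates {R X : Finset V} {ε α : ℝ} (hε : 0 < ε) (hα : 0 < α) {F : Finset E}
    (h : H.Saturates R ε α F X) : H.vol X ≤ H.vol R / ε := by
  have h0 := h ∅
  simp only [hyperedgeCut, Finset.inter_empty, H.w_empty, Finset.sum_const_zero,
    Finset.sdiff_empty, zero_add] at h0
  rw [le_div_iff₀ hε, mul_comm]
  rw [mul_assoc] at h0
  exact le_of_mul_le_mul_left h0 hα

/-! ### Executions -/

variable [DecidableEq E]

/-- The properties of a local hypergraph that every pass through the loop preserves, apart from the
iteration count and the cost: it is spanned by `R` and the explored nodes, and the sink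
edges of the explored nodes can be saturated. -/
structure Invariant (H : SplitHypergraph V E) (R : Finset V) (ε α : ℝ) (L : LocalState V E) :
    Prop where
  nodes_eq : L.nodes = H.neighborsSet (R ∪ L.explored)
  hyperedges_eq : L.hyperedges = H.incidentSet (R ∪ L.explored)
  terminals_eq : L.terminals = terminalEdges R L.nodes
  subset_nodes : R ∪ L.explored ⊆ L.nodes
  disjoint : Disjoint R L.explored
  saturates : H.Saturates R ε α L.hyperedges L.explored

namespace Invariant

variable {R : Finset V} {ε α : ℝ} {L : LocalState V E}

theorem init (hR : ∀ v ∈ R, ¬ H.Isolated v) (hα : 0 < α) :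
    H.Invariant R ε α (H.initState R) where
  nodes_eq := by
    simp [initState, Finset.union_eq_right.2 (subset_neighborsSet hR)]
  hyperedges_eq := by simp [initState]
  terminals_eq := rfl
  subset_nodes := by simp [initState]
  disjoint := Finset.disjoint_empty_right R
  saturates S := by
    have h1 := hyperedgeCut_nonneg (H := H) (H.incidentSet R) S
    have h2 := mul_nonneg hα.le (vol_nonneg (H := H) (R \ S))
    simpa [initState, vol] using add_nonneg h1 h2

theorem loopBody (hsub : H.IsSubmodular) (hε : 0 < ε) (hα : 0 < α) (h : H.Invariant R ε α L)
    {S : Finset V} (hS : H.IsMinLocalCut ε α L S) :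
    H.Invariant R ε α (H.loopBody R L S) where
  nodes_eq := by
    simp only [SplitHypergraph.loopBody]
    rw [← Finset.union_assoc, neighborsSet_union (R ∪ L.explored), h.nodes_eq]
  hyperedges_eq := by
    simp only [SplitHypergraph.loopBody]
    rw [← Finset.union_assoc, incidentSet_union (R ∪ L.explored), h.hyperedges_eq]
  terminals_eq := by
    simp only [SplitHypergraph.loopBody]
    rw [h.terminals_eq, terminalEdges, terminalEdges, terminalEdges, Finset.image_union]
  subset_nodes := by
    simp only [SplitHypergraph.loopBody]
    rw [← Finset.union_assoc]
    exact Finset.union_subset (h.subset_nodes.trans Finset.subset_union_left)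
      ((Finset.sdiff_subset.trans hS.1).trans Finset.subset_union_left)
  disjoint := by
    refine Finset.disjoint_union_right.2 ⟨h.disjoint, ?_⟩
    exact Finset.disjoint_sdiff.mono_left Finset.subset_union_left
  saturates :=
    (saturation_expand hsub hε hα h.terminals_eq
      (Finset.subset_union_left.trans h.subset_nodes) h.disjoint h.saturates hS).mono
      Finset.subset_union_left

theorem not_isolated (h : H.Invariant R ε α L) :
    ∀ v ∈ R ∪ L.explored, ¬ H.Isolated v := fun _ hv =>
  not_isolated_of_mem_neighborsSet (h.nodes_eq ▸ h.subset_nodes hv)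

theorem vol_explored_le (h : H.Invariant R ε α L) (hε : 0 < ε) (hα : 0 < α) :
    H.vol L.explored ≤ H.vol R / ε :=
  vol_le_of_saturates hε hα h.saturates

theorem vol_union_explored_le (h : H.Invariant R ε α L) (hε : 0 < ε) (hα : 0 < α) :
    H.vol (R ∪ L.explored) ≤ H.vol R * (1 + 1 / ε) := by
  have := h.vol_explored_le hε hα
  rw [vol_union h.disjoint, mul_add, mul_one, mul_one_div]
  linarith

theorem card_hyperedges_le (h : H.Invariant R ε α L) (hcard : H.CardinalityBased)
    (hsub : H.IsSubmodular) (hmin : H.NonzeroPenaltiesGeOne) (hε : 0 < ε) (hα : 0 < α) :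
    (L.hyperedges.card : ℝ) ≤ 3 / 2 * (1 + 1 / ε) * H.vol R := by
  have h1 := card_incidentSet_le_vol hcard hsub hmin (R ∪ L.explored)
  rw [← h.hyperedges_eq] at h1
  have h2 := h.vol_union_explored_le hε hα
  have h3 : 0 ≤ H.vol R * (1 + 1 / ε) := mul_nonneg (vol_nonneg R) (by positivity)
  linarith

theorem card_nodes_le (h : H.Invariant R ε α L) (hcard : H.CardinalityBased)
    (hsub : H.IsSubmodular) (hmin : H.NonzeroPenaltiesGeOne) (hε : 0 < ε) (hα : 0 < α) :
    (L.nodes.card : ℝ) ≤ H.maxEdgeSize * H.vol R * (1 + 1 / ε) := by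
  rw [h.nodes_eq, mul_assoc]
  exact (card_neighborsSet_le hcard hsub hmin _).trans
    (mul_le_mul_of_nonneg_left (h.vol_union_explored_le hε hα) (Nat.cast_nonneg _))

theorem card_terminals_le (h : H.Invariant R ε α L) (hcard : H.CardinalityBased)
    (hsub : H.IsSubmodular) (hmin : H.NonzeroPenaltiesGeOne) (hε : 0 < ε) (hα : 0 < α) :
    (L.terminals.card : ℝ) ≤ H.maxEdgeSize * H.vol R * (1 + 1 / ε) := by
  refine le_trans ?_ (h.card_nodes_le hcard hsub hmin hε hα)
  rw [h.terminals_eq]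
  exact_mod_cast Finset.card_image_le

end Invariant

namespace Exec

variable {R : Finset V} {ε α : ℝ} {T : ℕ → ℕ → ℕ → ℕ → ℕ} {i c : ℕ} {L : LocalState V E}

theorem invariant (hsub : H.IsSubmodular) (hR : ∀ v ∈ R, ¬ H.Isolated v) (hε : 0 < ε)
    (hα : 0 < α) (hL : H.Exec R ε α T i c L) : H.Invariant R ε α L := by
  induction hL with
  | init => exact .init hR hα
  | pass S b _ _ hS _ ih => exact ih.loopBody hsub hε hα hS

/-- Every pass except possibly the last one explores a node. -/
theorem iterations_le (hL : H.Exec R ε α T i c L) :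
    i ≤ 1 + L.explored.card ∧ (L.frontier.Nonempty → i ≤ L.explored.card) := by
  induction hL with
  | init => simp [initState]
  | @pass i c L S b _ hcont _ _ ih =>
    have hle : i ≤ L.explored.card := hcont.elim (fun h => h ▸ Nat.zero_le _) ih.2
    have hdisj : Disjoint L.explored (S \ (R ∪ L.explored)) :=
      Finset.disjoint_sdiff.mono_left Finset.subset_union_right
    simp only [loopBody, Finset.card_union_of_disjoint hdisj]
    refine ⟨by omega, fun hN => ?_⟩
    have := hN.card_pos
    omega

/-- If `B` bounds the cost of a minimum cut on every local hypergraph satisfying the invariant,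
the total cost is that of exploring `R` and the explored nodes, plus `B` for each pass. -/
theorem cost_le (hsub : H.IsSubmodular) (hR : ∀ v ∈ R, ¬ H.Isolated v) (hε : 0 < ε) (hα : 0 < α)
    {B : ℕ} (hB : ∀ L : LocalState V E, H.Invariant R ε α L →
      T L.nodes.card L.hyperedges.card L.terminals.card (L.maxEdgeSize H) ≤ B)
    (hL : H.Exec R ε α T i c L) : c ≤ H.exploreCost (R ∪ L.explored) + i * B := by
  induction hL with
  | init => simp [initState]
  | @pass i c L S b hL _ _ hb ih =>
    have hb' := hb.trans (hB L (hL.invariant hsub hR hε hα))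
    simp only [loopBody]
    rw [← Finset.union_assoc, exploreCost_union Finset.disjoint_sdiff, add_mul, one_mul]
    omega

end Exec

end SplitHypergraph

theorem theorem3 {V E : Type*} [DecidableEq V] [Fintype E] [DecidableEq E]
    (H : SplitHypergraph V E) (hcard : H.CardinalityBased) (hsub : H.IsSubmodular)
    (hmin : H.NonzeroPenaltiesGeOne)
    (R : Finset V) (hR : ∀ v ∈ R, ¬ H.Isolated v)
    (ε α : ℝ) (hε : 0 < ε) (hα : 0 < α)
    (T : ℕ → ℕ → ℕ → ℕ → ℕ)
    (hT : ∀ n n' m m' τ τ' κ κ' : ℕ, n ≤ n' → m ≤ m' → τ ≤ τ' → κ ≤ κ' →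
      T n m τ κ ≤ T n' m' τ' κ')
    (i c : ℕ) (L : SplitHypergraph.LocalState V E) (hL : H.Exec R ε α T i c L) :
    (L.hyperedges.card : ℝ) ≤ 3 / 2 * (1 + 1 / ε) * H.vol R ∧
    (L.nodes.card : ℝ) ≤ H.maxEdgeSize * H.vol R * (1 + 1 / ε) ∧
    (L.terminals.card : ℝ) ≤ H.maxEdgeSize * H.vol R * (1 + 1 / ε) ∧
    (i : ℝ) ≤ 1 + H.vol R / ε ∧
    (c : ℝ) ≤ (1 + H.maxEdgeSize) * H.vol R * (1 + 1 / ε) +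
      (1 + H.vol R / ε) *
        T ⌊H.maxEdgeSize * H.vol R * (1 + 1 / ε)⌋₊ ⌊3 / 2 * (1 + 1 / ε) * H.vol R⌋₊
          ⌊H.maxEdgeSize * H.vol R * (1 + 1 / ε)⌋₊ H.maxEdgeSize := by
  have hinv := hL.invariant hsub hR hε hα
  have hiter : (i : ℝ) ≤ 1 + H.vol R / ε := by
    have h1 : (i : ℝ) ≤ 1 + L.explored.card := by exact_mod_cast hL.iterations_le.1
    have h2 := SplitHypergraph.card_le_vol hcard hsub hmin fun v hv =>
      hinv.not_isolated v (Finset.mem_union_right R hv)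
    have h3 := hinv.vol_explored_le hε hα
    linarith
  refine ⟨hinv.card_hyperedges_le hcard hsub hmin hε hα, hinv.card_nodes_le hcard hsub hmin hε hα,
    hinv.card_terminals_le hcard hsub hmin hε hα, hiter, ?_⟩
  have hcost := hL.cost_le hsub hR hε hα fun L' h' =>
    hT _ _ _ _ _ _ _ _ (Nat.le_floor (h'.card_nodes_le hcard hsub hmin hε hα))
      (Nat.le_floor (h'.card_hyperedges_le hcard hsub hmin hε hα))
      (Nat.le_floor (h'.card_terminals_le hcard hsub hmin hε hα))
      (SplitHypergraph.localMaxEdgeSize_le L')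
  refine (Nat.cast_le.2 hcost).trans ?_
  rw [Nat.cast_add, Nat.cast_mul]
  refine add_le_add ?_ (mul_le_mul_of_nonneg_right hiter (Nat.cast_nonneg _))
  rw [mul_assoc]
  exact (SplitHypergraph.exploreCost_le hcard hsub hmin hinv.not_isolated).trans
    (mul_le_mul_of_nonneg_left (hinv.vol_union_explored_le hε hα) (by positivity))
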